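/- The closed EML expressions are generated by the constant $1$ and the binary symbol $E(\cdot,\cdot)$. Their values are given recursively by $[\![1]\!]=1$ and $[\![E(\alpha,\beta)]\!]=\exp([\![\alpha]\!])-\log([\![\beta]\!])$, where $\log$ is the principal branch of the complex logarithm on $\mathbb{C}\setminus\{0\}$ (imaginary part in $(-\pi,\pi]$); $[\![E(\alpha,\beta)]\!]$ is defined if and only if $[\![\alpha]\!]$ and $[\![\beta]\!]$ are defined and $[\![\beta]\!]\neq 0$. Let $EML\subseteq\mathbb{C}$ be the set of all defined values and $EML_{\mathbb{R}}=EML\cap\mathbb{R}$. A prefix-free machine is a partial computable function $M:\{0,1\}^*\rightharpoonup\{0,1\}^*$ (a function computed by a Turing machine) such that no element of $\mathrm{dom}(M)$ is a proper prefix of another. A prefix-free machine $U$ is universal if for every prefix-free machine $M$ there is a constant $c$ such that for every $p\in\mathrm{dom}(M)$ there is $q\in\mathrm{dom}(U)$ with $|q|\le|p|+c$ and $U(q)=M(p)$. Its halting probability is $\Omega_U=\sum_{p\in\mathrm{dom}(U)}2^{-|p|}$. A real $x$ is computable if there is an algorithm which, on input $k\in\mathbb{N}$, outputs a rational number within $2^{-k}$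 of $x$. Theorem. (1) For every universal prefix-free machine $U$, $\Omega_U\notin EML_{\mathbb{R}}$. (2) More generally, if $r\in\mathbb{R}$ is not computable, then $r\notin EML_{\mathbb{R}}$, i.e. there is no EML expression $\varphi$ whose value $[\![\varphi]\!]$ is defined and equals $r$. -/

import Mathlib

/-! ### EML expressions -/

/-- Closed EML expressions: `1` is one, and `E(α, β)` is one whenever `α` and `β` are. -/
inductive EMLExpr : Type
  | one : EMLExpr
  | E : EMLExpr → EMLExpr → EMLExpr

namespace EMLExpr

/-- The value `⟦φ⟧`, given by `⟦1⟧ = 1` and `⟦E(α, β)⟧ = exp ⟦α⟧ - log ⟦β⟧`, where `log` is the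
principal branch (imaginary part in `(-π, π]`). It is meaningful only when `φ.Defined`. -/
noncomputable def interp : EMLExpr → ℂ
  | one => 1
  | E α β => Complex.exp α.interp - Complex.log β.interp

/-- `⟦φ⟧` is defined: no logarithm of `0` is taken anywhere in the evaluation of `φ`. -/
def Defined : EMLExpr → Prop
  | one => True
  | E α β => α.Defined ∧ β.Defined ∧ β.interp ≠ 0

end EMLExpr

/-- The set `EML` of the values of all EML expressions whose value is defined. -/
def EML : Set ℂ := {z | ∃ φ : EMLExpr, φ.Defined ∧ φ.interp = z}

/-- `EML_ℝ = EML ∩ ℝ`. -/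
def EMLReal : Set ℝ := {x | (x : ℂ) ∈ EML}

/-! ### Computable reals -/

/-- A real `x` is computable if some algorithm outputs, on input `k`, (the numerator and the
denominator of) a rational number within `2 ^ (-k)` of `x`. -/
def IsComputableReal (x : ℝ) : Prop :=
  ∃ (a : ℕ → ℤ) (b : ℕ → ℕ), Computable a ∧ Computable b ∧
    ∀ k, b k ≠ 0 ∧ |x - (a k : ℝ) / (b k : ℝ)| ≤ 1 / 2 ^ k

/-! ### Prefix-free machines and halting probabilities -/

/-- A set of binary strings is prefix-free if no element of it is a proper prefix of another. -/
def IsPrefixFree (S : Set (List Bool)) : Prop :=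
  ∀ p ∈ S, ∀ q ∈ S, p <+: q → p = q

/-- A prefix-free machine: a partial computable function from binary strings (programs) to binary
strings (outputs) whose domain, the set of halting programs, is prefix-free. -/
structure IsPrefixFreeMachine (M : List Bool →. List Bool) : Prop where
  partrec : Partrec M
  prefixFree : IsPrefixFree M.Dom

/-- A universal prefix-free machine: it simulates every prefix-free machine `M` with programs that
are longer by at most a constant depending only on `M`. In particular this holds if for each `M`
there is a string `ρ` with `U (ρ ++ p) = M p` for all `p`. -/
structure IsUniversalPrefixFreeMachine (U : List Bool →. List Bool) : Prop
    extends IsPrefixFreeMachine U where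
  universal : ∀ M : List Bool →. List Bool, IsPrefixFreeMachine M →
    ∃ c : ℕ, ∀ p x, x ∈ M p → ∃ q : List Bool, q.length ≤ p.length + c ∧ x ∈ U q

/-- The halting probability `Ω_U`, the sum of `2 ^ (-|p|)` over all halting programs `p`. -/
noncomputable def haltingProbability (U : List Bool →. List Bool) : ℝ :=
  ∑' p : U.Dom, (1 / 2 : ℝ) ^ (p : List Bool).length

/-- Kraft's inequality: the sum over a prefix-free set converges, so that the sum defining the
halting probability of a prefix-free machine is meaningful. -/
theorem IsPrefixFree.summable {S : Set (List Bool)} (h : IsPrefixFree S) :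
    Summable fun p : S => (1 / 2 : ℝ) ^ (p : List Bool).length := by
  classical
  by_cases hnil : [] ∈ S
  · have : Subsingleton S :=
      ⟨fun a b => Subtype.ext ((h _ hnil _ a.2 List.nil_prefix).symm.trans
        (h _ hnil _ b.2 List.nil_prefix))⟩
    exact Summable.of_finite
  have hud : InformationTheory.UniquelyDecodable S := by
    intro L₁
    induction L₁ with
    | nil =>
      intro L₂ _ h₂ heq
      cases L₂ with
      | nil => rfl
      | cons b l =>
        have hb : b = [] := by
          have := heq.symm
          simp at this
          exact this.1
        exact absurd (hb ▸ h₂ b (by simp)) hnil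
    | cons a l ih =>
      intro L₂ h₁ h₂ heq
      cases L₂ with
      | nil =>
        have ha : a = [] := by
          simp at heq
          exact heq.1
        exact absurd (ha ▸ h₁ a (by simp)) hnil
      | cons b m =>
        rw [List.flatten_cons, List.flatten_cons] at heq
        have ha : a ∈ S := h₁ a (by simp)
        have hb : b ∈ S := h₂ b (by simp)
        have hpa : a <+: b ++ m.flatten := ⟨_, heq⟩
        have hab : a = b := by
          rcases List.prefix_or_prefix_of_prefix hpa (List.prefix_append b m.flatten) with h' | h'
          · exact h a ha b hb h'
          · exact (h b hb a ha h').symm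
        subst hab
        rw [ih m (fun w hw => h₁ w (by simp [hw])) (fun w hw => h₂ w (by simp [hw]))
          (List.append_cancel_left heq)]
  refine summable_of_sum_le (c := 1) (fun _ => by positivity) fun u => ?_
  have hu : InformationTheory.UniquelyDecodable
      ((u.map (Function.Embedding.subtype _) : Finset (List Bool)) : Set (List Bool)) := by
    intro L₁ L₂ h₁ h₂
    refine hud L₁ L₂ (fun w hw => ?_) (fun w hw => ?_)
    · obtain ⟨x, -, rfl⟩ := Finset.mem_map.1 (h₁ w hw)
      exact x.2
    · obtain ⟨x, -, rfl⟩ := Finset.mem_map.1 (h₂ w hw)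
      exact x.2
  have := InformationTheory.kraft_mcmillan_inequality hu
  simpa [Finset.sum_map] using this

/-! Both claims follow from two facts: every real EML value is computable, and no universal halting
probability is. For the first, computable complex numbers contain 1 and are closed under
subtraction, `exp` and `log` away from 0 (`IsComputableComplex.exp`, `IsComputableComplex.of_exp`),
so induction on the expression applies. Uniformity in the expression is not needed: each algorithm
may have finitely many facts about its number built in, such as an error bound or a rough location.
Hence no zero test and no decision about the branch cut is required. Both closure steps search for a
Gaussian integer that passes an exact integer test comparing `z / N` with `(1 + w / N ^ 2) ^ N`. For
the second, a computable halting probability would give a stage by which all halting programs of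
length at most `m` have halted (`exists_computable_stage`). A prefix-free machine could then print,
from a program of length `n + 1`, a string longer than every output of `U` on programs of length at
most `2 * n`; universality forbids this for large `n`. -/

/-! ### Primitive recursion on the integers -/

namespace Primrec

/-- Parity of the code gives the sign, so integer operations reduce to operations on natural
numbers. -/
theorem int_encode_ofNat (n : ℕ) : Encodable.encode (n : ℤ) = 2 * n := rfl

theorem int_encode_negSucc (n : ℕ) : Encodable.encode (Int.negSucc n) = 2 * n + 1 := rfl

theorem int_ofNat : Primrec (fun n : ℕ => (n : ℤ)) :=
  Primrec.encode_iff.1 (Primrec.nat_double.of_eq int_encode_ofNat)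

theorem int_negSucc : Primrec Int.negSucc :=
  Primrec.encode_iff.1 (Primrec.nat_double_succ.of_eq int_encode_negSucc)

theorem int_toNat : Primrec Int.toNat := by
  have h : Primrec fun x : ℤ =>
      bif (Encodable.encode x).bodd then 0 else (Encodable.encode x).div2 :=
    Primrec.cond (Primrec.nat_bodd.comp Primrec.encode) (Primrec.const 0)
      (Primrec.nat_div2.comp Primrec.encode)
  refine h.of_eq fun x => ?_
  cases x with
  | ofNat n => simp [int_encode_ofNat, Nat.div2_val]
  | negSucc n => simp [int_encode_negSucc]

theorem int_neg_toNat : Primrec fun x : ℤ => (-x).toNat := by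
  have h : Primrec fun x : ℤ =>
      bif (Encodable.encode x).bodd then (Encodable.encode x).div2 + 1 else 0 :=
    Primrec.cond (Primrec.nat_bodd.comp Primrec.encode)
      (Primrec.succ.comp (Primrec.nat_div2.comp Primrec.encode)) (Primrec.const 0)
  refine h.of_eq fun x => ?_
  cases x with
  | ofNat n => simp [int_encode_ofNat, Nat.div2_val]
  | negSucc n => simp [int_encode_negSucc, Nat.div2_val]

/-- Splitting each integer into positive and negative parts turns the ring operations into
differences of natural numbers. -/
theorem int_natSub : Primrec₂ fun m n : ℕ => (m : ℤ) - n := by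
  have h : Primrec₂ fun m n : ℕ =>
      if n ≤ m then ((m - n : ℕ) : ℤ) else Int.negSucc (n - m - 1) :=
    Primrec.ite (c := fun p : ℕ × ℕ => p.2 ≤ p.1) (Primrec.nat_le.comp Primrec.snd Primrec.fst)
      (int_ofNat.comp (Primrec.nat_sub.comp Primrec.fst Primrec.snd))
      (int_negSucc.comp (Primrec.nat_sub.comp (Primrec.nat_sub.comp Primrec.snd Primrec.fst)
        (Primrec.const 1)))
  refine h.of_eq fun m n => ?_
  split_ifs with hmn
  · exact Int.ofNat_sub hmn
  · rw [Int.negSucc_eq]; omega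

theorem int_add : Primrec₂ ((· + ·) : ℤ → ℤ → ℤ) := by
  have h : Primrec₂ fun x y : ℤ =>
      ((x.toNat + y.toNat : ℕ) : ℤ) - ((-x).toNat + (-y).toNat : ℕ) :=
    int_natSub.comp
      (Primrec.nat_add.comp (int_toNat.comp Primrec.fst) (int_toNat.comp Primrec.snd))
      (Primrec.nat_add.comp (int_neg_toNat.comp Primrec.fst) (int_neg_toNat.comp Primrec.snd))
  refine h.of_eq fun x y => ?_
  push_cast
  linarith [Int.toNat_sub_toNat_neg x, Int.toNat_sub_toNat_neg y]

theorem int_neg : Primrec (fun x : ℤ => -x) :=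
  (int_natSub.comp int_neg_toNat int_toNat).of_eq fun x => by
    linarith [Int.toNat_sub_toNat_neg x]

theorem int_sub : Primrec₂ ((· - ·) : ℤ → ℤ → ℤ) :=
  (int_add.comp₂ Primrec₂.left (int_neg.comp₂ Primrec₂.right)).of_eq fun x y =>
    (sub_eq_add_neg x y).symm

theorem int_mul : Primrec₂ ((· * ·) : ℤ → ℤ → ℤ) := by
  have h : Primrec₂ fun x y : ℤ =>
      ((x.toNat * y.toNat + (-x).toNat * (-y).toNat : ℕ) : ℤ) -
        (x.toNat * (-y).toNat + (-x).toNat * y.toNat : ℕ) := by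
    have hx := int_toNat.comp (Primrec.fst (α := ℤ) (β := ℤ))
    have hy := int_toNat.comp (Primrec.snd (α := ℤ) (β := ℤ))
    have hx' := int_neg_toNat.comp (Primrec.fst (α := ℤ) (β := ℤ))
    have hy' := int_neg_toNat.comp (Primrec.snd (α := ℤ) (β := ℤ))
    exact int_natSub.comp
      (Primrec.nat_add.comp (Primrec.nat_mul.comp hx hy) (Primrec.nat_mul.comp hx' hy'))
      (Primrec.nat_add.comp (Primrec.nat_mul.comp hx hy') (Primrec.nat_mul.comp hx' hy))
  refine h.of_eq fun x y => ?_
  conv_rhs => rw [← Int.toNat_sub_toNat_neg x, ← Int.toNat_sub_toNat_neg y]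
  push_cast
  ring

theorem int_natAbs : Primrec Int.natAbs :=
  (Primrec.nat_add.comp int_toNat int_neg_toNat).of_eq fun x => by omega

theorem nat_pow : Primrec₂ ((· ^ ·) : ℕ → ℕ → ℕ) :=
  Primrec₂.unpaired'.1 Nat.Primrec.pow

/-- Bounded summation is primitive recursive. -/
theorem nat_sum_range {α : Type*} [Primcodable α] {f : α → ℕ → ℕ} {g : α → ℕ}
    (hf : Primrec₂ f) (hg : Primrec g) :
    Primrec fun a => ∑ i ∈ Finset.range (g a), f a i := by
  have h : Primrec fun a => Nat.rec (motive := fun _ => ℕ) 0 (fun i s => s + f a i) (g a) :=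
    Primrec.nat_rec' hg (Primrec.const 0)
      (Primrec.nat_add.comp (Primrec.snd.comp Primrec.snd)
        (hf.comp Primrec.fst (Primrec.fst.comp Primrec.snd))).to₂
  refine h.of_eq fun a => ?_
  induction g a with
  | zero => rfl
  | succ n ih => rw [Finset.sum_range_succ, ← ih]

end Primrec

/-- Unbounded search: a computable relation that is total has a computable choice function. -/
theorem Computable.exists_choice {α β : Type*} [Primcodable α] [Primcodable β]
    {p : α → β → Bool} (hp : Computable₂ p) (h : ∀ a, ∃ b, p a b = true) :
    ∃ f : α → β, Computable f ∧ ∀ a, p a (f a) = true := by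
  let F : α → ℕ → Option β := fun a n =>
    (Encodable.decode (α := β) n).bind fun b => bif p a b then some b else none
  have hF : Computable₂ F := by
    refine Computable.option_bind (Computable.decode.comp Computable.snd) ?_
    exact Computable.cond (hp.comp (Computable.fst.comp Computable.fst) Computable.snd)
      (Computable.option_some.comp Computable.snd) (Computable.const none)
  have hmem : ∀ a n b, b ∈ F a n → p a b = true := by
    intro a n b hb
    obtain ⟨b', -, hb'⟩ := Option.bind_eq_some_iff.1 hb
    cases hpb : p a b' <;> simp [hpb] at hb'
    exact hb' ▸ hpb
  have hdom : ∀ a, (Nat.rfindOpt (F a)).Dom := by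
    intro a
    obtain ⟨b, hb⟩ := h a
    exact Nat.rfindOpt_dom.2 ⟨Encodable.encode b, b, by simp [F, hb]⟩
  refine ⟨fun a => (Nat.rfindOpt (F a)).get (hdom a),
    (Partrec.rfindOpt hF).of_eq_tot fun a => Part.get_mem _, fun a => ?_⟩
  obtain ⟨n, hn⟩ := Nat.rfindOpt_spec (Part.get_mem (hdom a))
  exact hmem a n _ hn

/-! ### Gaussian integers as pairs -/

/-- The product of Gaussian integers. -/
def gaussMul (x y : ℤ × ℤ) : ℤ × ℤ := (x.1 * y.1 - x.2 * y.2, x.1 * y.2 + x.2 * y.1)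

/-- The powers of a Gaussian integer. -/
def gaussPow (x : ℤ × ℤ) (n : ℕ) : ℤ × ℤ :=
  Nat.rec (motive := fun _ => ℤ × ℤ) (1, 0) (fun _ y => gaussMul y x) n

/-- The complex number represented by a pair of integers. -/
noncomputable def gaussC (x : ℤ × ℤ) : ℂ := ⟨x.1, x.2⟩

theorem primrec_gaussMul : Primrec₂ gaussMul := by
  have h1 := (Primrec.fst (α := ℤ) (β := ℤ)).comp (Primrec.fst (α := ℤ × ℤ) (β := ℤ × ℤ))
  have h2 := (Primrec.snd (α := ℤ) (β := ℤ)).comp (Primrec.fst (α := ℤ × ℤ) (β := ℤ × ℤ))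
  have h3 := (Primrec.fst (α := ℤ) (β := ℤ)).comp (Primrec.snd (α := ℤ × ℤ) (β := ℤ × ℤ))
  have h4 := (Primrec.snd (α := ℤ) (β := ℤ)).comp (Primrec.snd (α := ℤ × ℤ) (β := ℤ × ℤ))
  exact Primrec.pair
    (Primrec.int_sub.comp (Primrec.int_mul.comp h1 h3) (Primrec.int_mul.comp h2 h4))
    (Primrec.int_add.comp (Primrec.int_mul.comp h1 h4) (Primrec.int_mul.comp h2 h3))

theorem primrec_gaussPow : Primrec₂ gaussPow :=
  Primrec.nat_rec' Primrec.snd (Primrec.const (1, 0))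
    (primrec_gaussMul.comp (Primrec.snd.comp Primrec.snd) (Primrec.fst.comp Primrec.fst)).to₂

theorem primrec_gauss_add : Primrec₂ ((· + ·) : ℤ × ℤ → ℤ × ℤ → ℤ × ℤ) :=
  Primrec.pair
    (Primrec.int_add.comp (Primrec.fst.comp Primrec.fst) (Primrec.fst.comp Primrec.snd))
    (Primrec.int_add.comp (Primrec.snd.comp Primrec.fst) (Primrec.snd.comp Primrec.snd))

theorem primrec_gauss_sub : Primrec₂ ((· - ·) : ℤ × ℤ → ℤ × ℤ → ℤ × ℤ) :=
  Primrec.pair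
    (Primrec.int_sub.comp (Primrec.fst.comp Primrec.fst) (Primrec.fst.comp Primrec.snd))
    (Primrec.int_sub.comp (Primrec.snd.comp Primrec.fst) (Primrec.snd.comp Primrec.snd))

theorem gaussC_add (x y : ℤ × ℤ) : gaussC (x + y) = gaussC x + gaussC y := by
  apply Complex.ext <;> simp [gaussC]

theorem gaussC_sub (x y : ℤ × ℤ) : gaussC (x - y) = gaussC x - gaussC y := by
  apply Complex.ext <;> simp [gaussC]

theorem gaussC_natCast (n : ℕ) : gaussC ((n : ℤ), 0) = n := by
  apply Complex.ext <;> simp [gaussC]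

theorem gaussC_mul (x y : ℤ × ℤ) : gaussC (gaussMul x y) = gaussC x * gaussC y := by
  apply Complex.ext <;> simp [gaussC, gaussMul]

theorem gaussC_pow (x : ℤ × ℤ) (n : ℕ) : gaussC (gaussPow x n) = gaussC x ^ n := by
  induction n with
  | zero => apply Complex.ext <;> simp [gaussC, gaussPow]
  | succ n ih => rw [pow_succ, ← ih, ← gaussC_mul]; rfl

/-- The size `max |re| |im|` of a Gaussian integer. -/
def gaussSize (x : ℤ × ℤ) : ℕ := max x.1.natAbs x.2.natAbs

theorem primrec_gaussSize : Primrec gaussSize :=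
  Primrec.nat_max.comp (Primrec.int_natAbs.comp Primrec.fst) (Primrec.int_natAbs.comp Primrec.snd)

theorem gaussSize_le_norm (x : ℤ × ℤ) : (gaussSize x : ℝ) ≤ ‖gaussC x‖ := by
  have h1 := Complex.abs_re_le_norm (gaussC x)
  have h2 := Complex.abs_im_le_norm (gaussC x)
  simp only [gaussSize, Nat.cast_max, Nat.cast_natAbs, Int.cast_abs]
  exact max_le h1 h2

theorem norm_le_two_mul_gaussSize (x : ℤ × ℤ) : ‖gaussC x‖ ≤ 2 * gaussSize x := by
  refine (Complex.norm_le_abs_re_add_abs_im _).trans ?_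
  simp only [gaussSize, gaussC, Nat.cast_max, Nat.cast_natAbs, Int.cast_abs]
  linarith [le_max_left |(x.1 : ℝ)| |(x.2 : ℝ)|, le_max_right |(x.1 : ℝ)| |(x.2 : ℝ)|]

/-- The Gaussian integer obtained by rounding down both coordinates. -/
noncomputable def gaussFloor (z : ℂ) : ℤ × ℤ := (⌊z.re⌋, ⌊z.im⌋)

theorem norm_sub_gaussFloor_le (z : ℂ) : ‖z - gaussC (gaussFloor z)‖ ≤ 2 := by
  refine (Complex.norm_le_abs_re_add_abs_im _).trans ?_
  simp only [gaussC, gaussFloor, Complex.sub_re, Complex.sub_im, Int.self_sub_floor, Int.abs_fract]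
  linarith [Int.fract_lt_one z.re, Int.fract_lt_one z.im]

/-! ### Computable complex numbers -/

/-- A complex number `z` is computable if the Gaussian integers nearest to `N * z` can be computed
from `N`, up to a bounded error. -/
def IsComputableComplex (z : ℂ) : Prop :=
  ∃ f : ℕ → ℤ × ℤ, Computable f ∧ ∃ C : ℝ, ∀ N : ℕ, ‖N * z - gaussC (f N)‖ ≤ C

theorem isComputableComplex_one : IsComputableComplex 1 :=
  ⟨fun N => ((N : ℤ), 0), (Primrec.pair Primrec.int_ofNat (Primrec.const 0)).to_comp, 0,
    fun N => by simp [gaussC_natCast]⟩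

theorem IsComputableComplex.sub {z w : ℂ} (hz : IsComputableComplex z)
    (hw : IsComputableComplex w) : IsComputableComplex (z - w) := by
  obtain ⟨f, hf, C, hC⟩ := hz
  obtain ⟨g, hg, D, hD⟩ := hw
  refine ⟨fun N => f N - g N, primrec_gauss_sub.to_comp.comp hf hg, C + D, fun N => ?_⟩
  calc ‖N * (z - w) - gaussC (f N - g N)‖
      = ‖(N * z - gaussC (f N)) - (N * w - gaussC (g N))‖ := by rw [gaussC_sub]; ring_nf
    _ ≤ _ := (norm_sub_le _ _).trans (add_le_add (hC N) (hD N))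

theorem IsComputableComplex.isComputableReal {r : ℝ} (h : IsComputableComplex r) :
    IsComputableReal r := by
  obtain ⟨f, hf, C, hC⟩ := h
  -- Scaling by `K * 2 ^ k` with `C < K` absorbs the unknown constant; the 1 keeps the denominator
  -- nonzero.
  obtain ⟨K, hK⟩ := exists_nat_gt (max C 1)
  have hK1 : (1 : ℝ) < K := (le_max_right _ _).trans_lt hK
  have hKC : C < K := (le_max_left _ _).trans_lt hK
  have hb : Computable fun k : ℕ => K * 2 ^ k :=
    (Primrec.nat_mul.comp (Primrec.const K)
      (Primrec.nat_pow.comp (Primrec.const 2) Primrec.id)).to_comp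
  refine ⟨fun k => (f (K * 2 ^ k)).1, fun k => K * 2 ^ k,
    Computable.fst.comp (hf.comp hb), hb, fun k => ⟨?_, ?_⟩⟩
  · have : 0 < K := by exact_mod_cast zero_lt_one.trans hK1
    positivity
  · have h1 := (Complex.abs_re_le_norm _).trans (hC (K * 2 ^ k))
    have hpos : (0 : ℝ) < ((K * 2 ^ k : ℕ) : ℝ) := by push_cast; positivity
    have h2 : |((K * 2 ^ k : ℕ) : ℝ) * r - (f (K * 2 ^ k)).1| ≤ C := by
      refine le_of_eq_of_le ?_ h1
      rw [Complex.sub_re, ← Complex.ofReal_natCast, ← Complex.ofReal_mul, Complex.ofReal_re]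
      rfl
    have h3 : r - (f (K * 2 ^ k)).1 / ((K * 2 ^ k : ℕ) : ℝ) =
        (((K * 2 ^ k : ℕ) : ℝ) * r - (f (K * 2 ^ k)).1) / ((K * 2 ^ k : ℕ) : ℝ) := by
      field_simp
    rw [h3, abs_div, abs_of_pos hpos, div_le_div_iff₀ hpos (by positivity), one_mul]
    calc |((K * 2 ^ k : ℕ) : ℝ) * r - (f (K * 2 ^ k)).1| * 2 ^ k ≤ K * 2 ^ k := by
          gcongr
          exact h2.trans hKC.le
      _ = _ := by push_cast; rfl

/-! ### Approximating the exponential function -/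

theorem norm_pow_sub_pow_le {a b : ℂ} {r : ℝ} (hr : 0 ≤ r) (ha : ‖a‖ ≤ r) (hb : ‖b‖ ≤ r) (n : ℕ) :
    ‖a ^ n - b ^ n‖ ≤ n * r ^ (n - 1) * ‖a - b‖ := by
  rw [← (Commute.all a b).geom_sum₂_mul n, norm_mul]
  refine mul_le_mul_of_nonneg_right ?_ (norm_nonneg _)
  refine (norm_sum_le _ _).trans ((Finset.sum_le_card_nsmul _ _ (r ^ (n - 1)) fun i hi => ?_).trans
    (by simp))
  have hi' := Finset.mem_range.1 hi
  rw [norm_mul, norm_pow, norm_pow, show n - 1 = i + (n - 1 - i) by omega, pow_add,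
    show i + (n - 1 - i) - i = n - 1 - i by omega]
  gcongr

/-- The rate of convergence of `(1 + u / n) ^ n` to `exp u`. -/
theorem norm_one_add_div_pow_sub_exp_le {u : ℂ} {R : ℝ} (hR : ‖u‖ ≤ R) {n : ℕ} (hn : n ≠ 0)
    (hRn : R ≤ n) : ‖(1 + u / n) ^ n - Complex.exp u‖ ≤ Real.exp R * R ^ 2 / n := by
  have hn0 : (0 : ℝ) < n := by positivity
  have hR0 : 0 ≤ R := (norm_nonneg u).trans hR
  have hun : ‖u / n‖ ≤ R / n := by
    rw [norm_div, Complex.norm_natCast]; gcongr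
  have h1 : ‖(1 : ℂ) + u / n‖ ≤ Real.exp (R / n) := by
    refine (norm_add_le _ _).trans ?_
    rw [norm_one]
    linarith [Real.add_one_le_exp (R / n)]
  have h2 : ‖Complex.exp (u / n)‖ ≤ Real.exp (R / n) :=
    (Complex.norm_exp_le_exp_norm _).trans (Real.exp_le_exp.2 hun)
  -- The two bases differ by a second-order Taylor remainder; taking `n`-th powers multiplies this
  -- by about `n`, leaving order `1 / n`.
  have h3 : ‖(1 : ℂ) + u / n - Complex.exp (u / n)‖ ≤ (R / n) ^ 2 := by
    have h := Complex.norm_exp_sub_one_sub_id_le (x := u / n)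
      (hun.trans ((div_le_one hn0).2 hRn))
    rw [norm_sub_rev, ← sub_sub]
    exact h.trans (by gcongr)
  have h4 : Complex.exp u = Complex.exp (u / n) ^ n := by
    rw [← Complex.exp_nat_mul, mul_div_cancel₀ _ (by exact_mod_cast hn)]
  have h5 : Real.exp (R / n) ^ (n - 1) ≤ Real.exp R := by
    rw [← Real.exp_nat_mul]
    refine Real.exp_le_exp.2 ?_
    calc ((n - 1 : ℕ) : ℝ) * (R / n) ≤ n * (R / n) := by gcongr; omega
      _ = R := by field_simp
  calc ‖(1 + u / n) ^ n - Complex.exp u‖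
      ≤ n * Real.exp (R / n) ^ (n - 1) * ‖(1 : ℂ) + u / n - Complex.exp (u / n)‖ := by
        rw [h4]; exact norm_pow_sub_pow_le (Real.exp_pos _).le h1 h2 n
    _ ≤ n * Real.exp R * (R / n) ^ 2 := by gcongr
    _ = _ := by field_simp

theorem norm_exp_sub_exp_eq (u w : ℂ) :
    ‖Complex.exp u - Complex.exp w‖ = Real.exp w.re * ‖Complex.exp (u - w) - 1‖ := by
  rw [← Complex.norm_exp, ← norm_mul, mul_sub, ← Complex.exp_add]
  simp

theorem norm_exp_sub_exp_le {u w : ℂ} (h : ‖u - w‖ ≤ 1) :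
    ‖Complex.exp u - Complex.exp w‖ ≤ Real.exp w.re * (2 * ‖u - w‖) := by
  rw [norm_exp_sub_exp_eq]
  gcongr
  exact Complex.norm_exp_sub_one_le h

/-- Quantitative local injectivity, from `‖exp t - 1‖ ≥ ‖t‖ - ‖t‖ ^ 2 ≥ ‖t‖ / 2`. It turns closeness
of exponentials into closeness of logarithms. -/
theorem norm_sub_le_norm_exp_sub_exp {u w : ℂ} (h : ‖u - w‖ ≤ 1 / 2) :
    ‖u - w‖ ≤ 2 * Real.exp (-w.re) * ‖Complex.exp u - Complex.exp w‖ := by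
  rw [norm_exp_sub_exp_eq, Real.exp_neg]
  have h1 := Complex.norm_exp_sub_one_sub_id_le (x := u - w) (by linarith)
  have h2 := norm_sub_norm_le (u - w) (Complex.exp (u - w) - 1)
  rw [norm_sub_rev (u - w)] at h2
  have h3 : ‖u - w‖ ≤ 2 * ‖Complex.exp (u - w) - 1‖ := by nlinarith [norm_nonneg (u - w)]
  calc ‖u - w‖ ≤ 2 * ‖Complex.exp (u - w) - 1‖ := h3
    _ = _ := by field_simp

/-! ### Testing `z / N ≈ exp (w / N)` on Gaussian integers -/

/-- The Gaussian integer `N ^ (2 * N) * z - N * (N ^ 2 + w) ^ N`. -/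
def expDefect (N : ℕ) (w z : ℤ × ℤ) : ℤ × ℤ :=
  gaussMul (((N ^ (2 * N) : ℕ) : ℤ), 0) z -
    gaussMul ((N : ℤ), 0) (gaussPow ((((N ^ 2 : ℕ) : ℤ), 0) + w) N)

/-- Whether `z / N` is within about `K / N` of `(1 + (w / N) / N) ^ N`. -/
def expTest (K N : ℕ) (w z : ℤ × ℤ) : Bool :=
  decide (gaussSize (expDefect N w z) ≤ K * N ^ (2 * N))

theorem primrec_expTest (K : ℕ) :
    Primrec fun p : ℕ × (ℤ × ℤ) × (ℤ × ℤ) => expTest K p.1 p.2.1 p.2.2 := by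
  have hN : Primrec fun p : ℕ × (ℤ × ℤ) × (ℤ × ℤ) => p.1 := Primrec.fst
  have hw : Primrec fun p : ℕ × (ℤ × ℤ) × (ℤ × ℤ) => p.2.1 := Primrec.fst.comp Primrec.snd
  have hz : Primrec fun p : ℕ × (ℤ × ℤ) × (ℤ × ℤ) => p.2.2 := Primrec.snd.comp Primrec.snd
  have hcast : Primrec fun n : ℕ => ((n : ℤ), (0 : ℤ)) :=
    Primrec.pair Primrec.int_ofNat (Primrec.const 0)
  have hpow : Primrec fun p : ℕ × (ℤ × ℤ) × (ℤ × ℤ) => p.1 ^ (2 * p.1) :=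
    Primrec.nat_pow.comp hN (Primrec.nat_mul.comp (Primrec.const 2) hN)
  have hdef : Primrec fun p : ℕ × (ℤ × ℤ) × (ℤ × ℤ) => expDefect p.1 p.2.1 p.2.2 :=
    primrec_gauss_sub.comp (primrec_gaussMul.comp (hcast.comp hpow) hz)
      (primrec_gaussMul.comp (hcast.comp hN) (primrec_gaussPow.comp
        (primrec_gauss_add.comp (hcast.comp (Primrec.nat_pow.comp hN (Primrec.const 2))) hw) hN))
  exact PrimrecPred.decide (PrimrecRel.comp Primrec.nat_le (primrec_gaussSize.comp hdef)
    (Primrec.nat_mul.comp (Primrec.const K) hpow))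

/-- The factor `N ^ (2 * N)` clears all denominators, which makes the test decidable by integer
arithmetic. -/
theorem norm_expDefect (N : ℕ) (w z : ℤ × ℤ) :
    ‖gaussC (expDefect N w z)‖ =
      N ^ (2 * N) * ‖gaussC z - N * (1 + gaussC w / N / N) ^ N‖ := by
  rcases eq_or_ne N 0 with rfl | hN
  · simp [expDefect, gaussMul, gaussC]
  have hN' : (N : ℂ) ≠ 0 := by exact_mod_cast hN
  have h1 : (N : ℂ) ^ 2 + gaussC w = N ^ 2 * (1 + gaussC w / N / N) := by field_simp
  rw [expDefect, gaussC_sub, gaussC_mul, gaussC_mul, gaussC_pow, gaussC_add, gaussC_natCast,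
    gaussC_natCast, gaussC_natCast, Nat.cast_pow, Nat.cast_pow, h1, mul_pow, ← pow_mul,
    ← mul_left_comm, ← mul_sub, norm_mul, norm_pow, Complex.norm_natCast]

theorem expTest_of_norm_le {K N : ℕ} {w z : ℤ × ℤ}
    (h : ‖gaussC z - N * (1 + gaussC w / N / N) ^ N‖ ≤ K) : expTest K N w z = true := by
  rw [expTest, decide_eq_true_eq]
  have h1 := (gaussSize_le_norm (expDefect N w z)).trans_eq (norm_expDefect N w z)
  have h2 : (gaussSize (expDefect N w z) : ℝ) ≤ ((K * N ^ (2 * N) : ℕ) : ℝ) := by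
    refine h1.trans ?_
    push_cast
    rw [mul_comm]
    gcongr
  exact_mod_cast h2

/-- The factor 2 is the cost of testing the larger coordinate instead of the modulus. -/
theorem norm_le_of_expTest {K N : ℕ} {w z : ℤ × ℤ} (h : expTest K N w z = true) :
    ‖gaussC z - N * (1 + gaussC w / N / N) ^ N‖ ≤ 2 * K := by
  rw [expTest, decide_eq_true_eq] at h
  have h1 := (norm_expDefect N w z).symm.trans_le (norm_le_two_mul_gaussSize (expDefect N w z))
  have h2 : (gaussSize (expDefect N w z) : ℝ) ≤ K * (N : ℝ) ^ (2 * N) := by exact_mod_cast h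
  have hpos : (0 : ℝ) < (N : ℝ) ^ (2 * N) := by
    rcases eq_or_ne N 0 with rfl | hN
    · simp
    · positivity
  refine le_of_mul_le_mul_left ?_ hpos
  linarith

/-! ### Computable complex numbers are closed under `exp` and all branches of `log` -/

/-- Finitely many terms cannot spoil boundedness, so all error estimates are needed only for large
`N`. -/
theorem exists_forall_le_of_eventually_le {a : ℕ → ℝ} {C : ℝ} {M : ℕ} (h : ∀ N, M ≤ N → a N ≤ C) :
    ∃ B, ∀ N, a N ≤ B := by
  have h1 : Filter.IsBoundedUnder (· ≤ ·) Filter.atTop a :=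
    ⟨C, Filter.eventually_map.2 (Filter.eventually_atTop.2 ⟨M, h⟩)⟩
  obtain ⟨B, hB⟩ := h1.bddAbove_range
  exact ⟨B, fun N => hB ⟨N, rfl⟩⟩

theorem norm_mul_exp_sub_le {v : ℂ} {R : ℝ} {N : ℕ} (hN : N ≠ 0) (hRN : R ≤ N)
    (hv : ‖v / N‖ ≤ R) :
    ‖N * Complex.exp (v / N) - N * (1 + v / N / N) ^ N‖ ≤ Real.exp R * R ^ 2 := by
  have h := norm_one_add_div_pow_sub_exp_le hv hN hRN
  have hN0 : (0 : ℝ) < N := by positivity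
  rw [← mul_sub, norm_mul, Complex.norm_natCast, norm_sub_rev]
  calc _ ≤ N * (Real.exp R * R ^ 2 / N) := by gcongr
    _ = _ := by field_simp

theorem norm_div_sub_eq {v w : ℂ} {N : ℕ} (hN : N ≠ 0) : ‖v / N - w‖ = ‖N * w - v‖ / N := by
  have hN' : (N : ℂ) ≠ 0 := by exact_mod_cast hN
  rw [norm_sub_rev, show w - v / N = (N * w - v) / N by field_simp, norm_div, Complex.norm_natCast]

/-- Replacing `w` by `v N / N`, and then `exp` by the power, each costs `O(1 / N)`; multiplied by
`N`, both errors stay bounded. -/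
theorem exists_norm_mul_exp_sub_le {w : ℂ} {v : ℕ → ℂ} {C : ℝ} (h : ∀ N : ℕ, ‖N * w - v N‖ ≤ C) :
    ∃ B, ∀ N : ℕ, ‖N * Complex.exp w - N * (1 + v N / N / N) ^ N‖ ≤ B := by
  obtain ⟨M, hM⟩ := exists_nat_gt (max C (‖w‖ + 1))
  refine exists_forall_le_of_eventually_le (M := M)
    (C := Real.exp w.re * (2 * C) + Real.exp (‖w‖ + 1) * (‖w‖ + 1) ^ 2) fun N hN => ?_
  have hMN : (M : ℝ) ≤ N := by exact_mod_cast hN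
  have hC : C ≤ N := ((le_max_left _ _).trans hM.le).trans hMN
  have hR : ‖w‖ + 1 ≤ N := ((le_max_right _ _).trans hM.le).trans hMN
  have hN0 : (0 : ℝ) < N := by linarith [norm_nonneg w]
  have hN1 : N ≠ 0 := by rintro rfl; simp at hN0
  have hu : ‖v N / N - w‖ ≤ C / N := by
    rw [norm_div_sub_eq hN1]; gcongr; exact h N
  have hu1 : ‖v N / N - w‖ ≤ 1 := hu.trans ((div_le_one hN0).2 hC)
  have hu2 : ‖v N / N‖ ≤ ‖w‖ + 1 := by linarith [norm_sub_norm_le (v N / N) w]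
  have h1 : ‖N * Complex.exp w - N * Complex.exp (v N / N)‖ ≤ Real.exp w.re * (2 * C) := by
    rw [← mul_sub, norm_mul, Complex.norm_natCast, norm_sub_rev]
    calc _ ≤ N * (Real.exp w.re * (2 * ‖v N / N - w‖)) := by
          gcongr; exact norm_exp_sub_exp_le hu1
      _ ≤ N * (Real.exp w.re * (2 * (C / N))) := by gcongr
      _ = _ := by field_simp
  exact (norm_sub_le_norm_sub_add_norm_sub _ _ _).trans
    (add_le_add h1 (norm_mul_exp_sub_le hN1 hR hu2))

theorem computable_expTest {α : Type*} [Primcodable α] (K : ℕ) {n : α → ℕ} {w z : α → ℤ × ℤ}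
    (hn : Computable n) (hw : Computable w) (hz : Computable z) :
    Computable fun a => expTest K (n a) (w a) (z a) := by
  have h : Computable fun a => (n a, w a, z a) := hn.pair (hw.pair hz)
  have h' := Computable.comp (primrec_expTest K).to_comp h
  exact h'

theorem IsComputableComplex.exp {w : ℂ} (hw : IsComputableComplex w) :
    IsComputableComplex (Complex.exp w) := by
  obtain ⟨f, hf, C, hC⟩ := hw
  obtain ⟨B, hB⟩ := exists_norm_mul_exp_sub_le hC
  -- The tolerance 2 is the rounding error, so the search always succeeds.
  have hp : Computable₂ fun (N : ℕ) (z : ℤ × ℤ) => expTest 2 N (f N) z :=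
    computable_expTest 2 Computable.fst (hf.comp Computable.fst) Computable.snd
  obtain ⟨g, hg, hgt⟩ := Computable.exists_choice hp fun N =>
    ⟨gaussFloor (N * (1 + gaussC (f N) / N / N) ^ N), expTest_of_norm_le (by
      rw [norm_sub_rev]; exact_mod_cast norm_sub_gaussFloor_le _)⟩
  refine ⟨g, hg, B + 2 * (2 : ℕ), fun N => ?_⟩
  have h1 := norm_le_of_expTest (hgt N)
  rw [norm_sub_rev] at h1
  exact (norm_sub_le_norm_sub_add_norm_sub _ _ _).trans (add_le_add (hB N) h1)

/-- Whether `a / N` is close to `q / 16`. -/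
def nearTest (q : ℤ × ℤ) (N : ℕ) (a : ℤ × ℤ) : Bool :=
  decide (gaussSize (gaussMul (16, 0) a - gaussMul ((N : ℤ), 0) q) ≤ 2 * N + 32)

theorem primrec_nearTest (q : ℤ × ℤ) : Primrec₂ (nearTest q) := by
  refine PrimrecPred.decide (PrimrecRel.comp Primrec.nat_le (primrec_gaussSize.comp ?_) ?_)
  · exact primrec_gauss_sub.comp (primrec_gaussMul.comp (Primrec.const _) Primrec.snd)
      (primrec_gaussMul.comp ((Primrec.int_ofNat.comp Primrec.fst).pair (Primrec.const 0))
        (Primrec.const q))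
  · exact Primrec.nat_add.comp (Primrec.nat_mul.comp (Primrec.const 2) Primrec.fst)
      (Primrec.const 32)

theorem gaussC_nearTest (q : ℤ × ℤ) (N : ℕ) (a : ℤ × ℤ) :
    gaussC (gaussMul (16, 0) a - gaussMul ((N : ℤ), 0) q) = 16 * gaussC a - N * gaussC q := by
  rw [gaussC_sub, gaussC_mul, gaussC_mul, gaussC_natCast]
  congr 2
  exact_mod_cast gaussC_natCast 16

/-- Rounding `16 * w` costs `N * 2` and rounding `N * w` costs `16 * 2`, whence the threshold. -/
theorem nearTest_gaussFloor (w : ℂ) (N : ℕ) :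
    nearTest (gaussFloor (16 * w)) N (gaussFloor (N * w)) = true := by
  rw [nearTest, decide_eq_true_eq]
  have h := gaussSize_le_norm (gaussMul (16, 0) (gaussFloor (N * w)) -
    gaussMul ((N : ℤ), 0) (gaussFloor (16 * w)))
  rw [gaussC_nearTest] at h
  have h2 : ‖16 * gaussC (gaussFloor (N * w)) - N * gaussC (gaussFloor (16 * w))‖ ≤
      2 * N + 32 := by
    calc _ = ‖N * (16 * w - gaussC (gaussFloor (16 * w))) -
          16 * (N * w - gaussC (gaussFloor (N * w)))‖ := by ring_nf
      _ ≤ N * 2 + 16 * 2 := by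
        refine (norm_sub_le _ _).trans ?_
        rw [norm_mul, norm_mul, Complex.norm_natCast, Complex.norm_ofNat]
        gcongr <;> exact norm_sub_gaussFloor_le _
      _ = _ := by ring
  exact_mod_cast h.trans h2

/-- The total error `(6 * N + 64) / 16` is at most `N / 2` exactly when `N ≥ 32`; the radius `1 / 2`
is the one required by `norm_sub_le_norm_exp_sub_exp`. -/
theorem norm_div_sub_le_of_nearTest {w : ℂ} {N : ℕ} (hN : 32 ≤ N) {a : ℤ × ℤ}
    (h : nearTest (gaussFloor (16 * w)) N a = true) : ‖gaussC a / N - w‖ ≤ 1 / 2 := by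
  rw [nearTest, decide_eq_true_eq] at h
  have hN1 : (32 : ℝ) ≤ N := by exact_mod_cast hN
  have h1 := norm_le_two_mul_gaussSize
    (gaussMul (16, 0) a - gaussMul ((N : ℤ), 0) (gaussFloor (16 * w)))
  have h2 : ((gaussSize (gaussMul (16, 0) a - gaussMul ((N : ℤ), 0) (gaussFloor (16 * w))) : ℕ) : ℝ)
      ≤ 2 * N + 32 := by exact_mod_cast h
  rw [gaussC_nearTest] at h1
  have h3 : 16 * ‖N * w - gaussC a‖ ≤ N * 2 + 2 * (2 * N + 32) := by
    calc 16 * ‖N * w - gaussC a‖ = ‖N * (16 * w - gaussC (gaussFloor (16 * w))) -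
          (16 * gaussC a - N * gaussC (gaussFloor (16 * w)))‖ := by
          rw [← Complex.norm_ofNat, ← norm_mul]; ring_nf
      _ ≤ _ := by
        refine (norm_sub_le _ _).trans ?_
        rw [norm_mul, Complex.norm_natCast]
        gcongr
        · exact norm_sub_gaussFloor_le _
        · linarith
  rw [norm_div_sub_eq (by omega), div_le_iff₀ (by linarith)]
  linarith

/-- Every logarithm of a computable complex number is computable. -/
theorem IsComputableComplex.of_exp {w : ℂ} (h : IsComputableComplex (Complex.exp w)) :
    IsComputableComplex w := by
  obtain ⟨g, hg, D, hD⟩ := h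
  obtain ⟨B, hB⟩ := exists_norm_mul_exp_sub_le (w := w)
    (v := fun N => gaussC (gaussFloor (N * w))) fun N => norm_sub_gaussFloor_le _
  obtain ⟨K, hK⟩ := exists_nat_gt (D + B)
  -- The pair `gaussFloor (16 * w)` is a constant of the algorithm. It selects the logarithm `w`
  -- among its translates by multiples of `2πi`.
  have hp : Computable₂ fun (N : ℕ) (a : ℤ × ℤ) =>
      bif nearTest (gaussFloor (16 * w)) N a then expTest K N a (g N) else false :=
    Computable.cond (primrec_nearTest _).to_comp
      (computable_expTest K Computable.fst Computable.snd (hg.comp Computable.fst))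
      (Computable.const false)
  obtain ⟨f, hf, hft⟩ := Computable.exists_choice hp fun N => by
    refine ⟨gaussFloor (N * w), ?_⟩
    rw [nearTest_gaussFloor, cond_true]
    refine expTest_of_norm_le (le_trans ?_ hK.le)
    have h1 := hD N
    rw [norm_sub_rev] at h1
    exact (norm_sub_le_norm_sub_add_norm_sub _ _ _).trans (add_le_add h1 (hB N))
  obtain ⟨M, hM⟩ := exists_nat_gt (max 32 (‖w‖ + 1 / 2))
  have key : ∀ N, M ≤ N → ‖N * w - gaussC (f N)‖ ≤ 2 * Real.exp (-w.re) *
      (Real.exp (‖w‖ + 1 / 2) * (‖w‖ + 1 / 2) ^ 2 + (2 * K + D)) := by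
    intro N hN
    have hMN : (M : ℝ) ≤ N := by exact_mod_cast hN
    have hR : ‖w‖ + 1 / 2 ≤ N := ((le_max_right _ _).trans hM.le).trans hMN
    have h32 : 32 ≤ N := by exact_mod_cast ((le_max_left _ _).trans hM.le).trans hMN
    have hN1 : N ≠ 0 := by omega
    have hN0 : (0 : ℝ) < N := by positivity
    obtain ⟨hn, he⟩ : nearTest (gaussFloor (16 * w)) N (f N) = true ∧
        expTest K N (f N) (g N) = true := by simpa using hft N
    have h1 := norm_div_sub_le_of_nearTest h32 hn
    have h2 : ‖gaussC (f N) / N‖ ≤ ‖w‖ + 1 / 2 := by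
      linarith [norm_sub_norm_le (gaussC (f N) / N) w]
    have h3 : ‖N * Complex.exp (gaussC (f N) / N) - N * Complex.exp w‖ ≤
        Real.exp (‖w‖ + 1 / 2) * (‖w‖ + 1 / 2) ^ 2 + (2 * K + D) := by
      have ha := norm_mul_exp_sub_le hN1 hR h2
      have hb := norm_le_of_expTest he
      have hc := hD N
      rw [norm_sub_rev] at hb hc
      exact (norm_sub_le_norm_sub_add_norm_sub _ _ _).trans
        (add_le_add ha ((norm_sub_le_norm_sub_add_norm_sub _ _ _).trans (add_le_add hb hc)))
    rw [← mul_sub, norm_mul, Complex.norm_natCast] at h3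
    have h4 := norm_sub_le_norm_exp_sub_exp h1
    rw [norm_div_sub_eq hN1, div_le_iff₀ hN0] at h4
    refine h4.trans ?_
    rw [mul_assoc, mul_comm _ (N : ℝ)]
    gcongr
  exact ⟨f, hf, exists_forall_le_of_eventually_le key⟩

/-- Only `exp (log z) = z` matters, so the discontinuity at the branch cut is harmless. -/
theorem IsComputableComplex.log {z : ℂ} (hz : IsComputableComplex z) (h0 : z ≠ 0) :
    IsComputableComplex (Complex.log z) :=
  .of_exp (by rwa [Complex.exp_log h0])

theorem EMLExpr.Defined.isComputableComplex :
    ∀ {φ : EMLExpr}, φ.Defined → IsComputableComplex φ.interp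
  | .one, _ => isComputableComplex_one
  | .E _ _, h => h.1.isComputableComplex.exp.sub (h.2.1.isComputableComplex.log h.2.2)

theorem isComputableReal_of_mem_EMLReal {r : ℝ} (h : r ∈ EMLReal) : IsComputableReal r := by
  obtain ⟨φ, hφ, h⟩ := h
  exact (h ▸ hφ.isComputableComplex : IsComputableComplex r).isComputableReal

/-! ### Halting probabilities of universal machines are not computable -/

section HaltingProbability

open Nat.Partrec

/-- The code `c` computes the partial function `U` on encoded strings. -/
def IsCodeOf (c : Code) (U : List Bool →. List Bool) : Prop :=
  c.eval = fun n => Part.bind (Encodable.decode₂ (List Bool) n) fun a =>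
    (U a).map Encodable.encode

theorem exists_isCodeOf {U : List Bool →. List Bool} (hU : Partrec U) : ∃ c, IsCodeOf c U :=
  Code.exists_code.1 (Partrec.bind_decode₂_iff.1 hU)

/-- Since `decode₂` accepts only genuine encodings, every input on which `c` halts is the code of a
program. -/
theorem IsCodeOf.mem_eval {c : Code} {U : List Bool →. List Bool} (hc : IsCodeOf c U) {i y : ℕ} :
    y ∈ c.eval i ↔ ∃ p x, Encodable.encode p = i ∧ x ∈ U p ∧ Encodable.encode x = y := by
  rw [hc]
  simp only [Part.mem_bind_iff, Part.mem_map_iff, Part.mem_coe, Encodable.mem_decode₂,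
    exists_and_left]

/-- The weight `2 ^ (s - |p|)` of the program `p` with code `i`, if it halts within `s` steps. -/
def stageWeight (c : Code) (s i : ℕ) : ℕ :=
  bif (Code.evaln s c i).isSome then
    2 ^ (s - ((Encodable.decode (α := List Bool) i).getD []).length) else 0

/-- `2 ^ s` times the halting probability at stage `s`. -/
def stageSum (c : Code) (s : ℕ) : ℕ := ∑ i ∈ Finset.range s, stageWeight c s i

/-- The length of the output of the program with code `i`, if it halts within `s` steps. -/
def stageOutputLength (c : Code) (s i : ℕ) : ℕ :=
  (((Code.evaln s c i).bind (Encodable.decode (α := List Bool))).getD []).length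

/-- A string longer than all outputs of programs that halt within `s` steps. -/
def longString (c : Code) (s : ℕ) : List Bool :=
  (List.range (∑ i ∈ Finset.range s, stageOutputLength c s i + 1)).map fun _ => false

theorem primrec_evaln (c : Code) : Primrec₂ fun s i : ℕ => Code.evaln s c i := by
  have h := Code.primrec_evaln.comp
    ((Primrec.fst.pair (Primrec.const c)).pair Primrec.snd : Primrec fun p : ℕ × ℕ => ((p.1, c), p.2))
  exact h

theorem primrec_decode_getD :
    Primrec fun i => (Encodable.decode (α := List Bool) i).getD [] :=
  Primrec.option_getD.comp Primrec.decode (Primrec.const [])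

theorem primrec_stageSum (c : Code) : Primrec (stageSum c) := by
  have h : Primrec₂ (stageWeight c) :=
    Primrec.cond (Primrec.option_isSome.comp (primrec_evaln c))
      (Primrec.nat_pow.comp (Primrec.const 2) (Primrec.nat_sub.comp Primrec.fst
        (Primrec.list_length.comp (primrec_decode_getD.comp Primrec.snd)))) (Primrec.const 0)
  exact Primrec.nat_sum_range h Primrec.id

theorem primrec_longString (c : Code) : Primrec (longString c) := by
  have h : Primrec₂ (stageOutputLength c) :=
    Primrec.list_length.comp (Primrec.option_getD.comp
      (Primrec.option_bind (primrec_evaln c) (Primrec.decode.comp Primrec.snd).to₂)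
      (Primrec.const []))
  exact Primrec.list_map (Primrec.list_range.comp
    (Primrec.succ.comp (Primrec.nat_sum_range h Primrec.id))) (Primrec.const false).to₂

theorem length_lt_longString {c : Code} {s i : ℕ} {x : List Bool}
    (h : Encodable.encode x ∈ Code.evaln s c i) : x.length < (longString c s).length := by
  have h1 : stageOutputLength c s i = x.length := by
    rw [stageOutputLength, Option.mem_def.1 h]; simp
  have h2 := Finset.single_le_sum (f := stageOutputLength c s) (fun _ _ => Nat.zero_le _)
    (Finset.mem_range.2 (Code.evaln_bound h))
  rw [longString, List.length_map, List.length_range]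
  omega

/-- As `evaln` at stage `s` halts only on inputs below `s`, this ensures that `s - |p|` in
`stageWeight` is not truncated. -/
theorem List.length_le_encode (p : List Bool) : p.length ≤ Encodable.encode p := by
  induction p with
  | nil => simp
  | cons a p ih =>
    rw [Encodable.encode_list_cons, List.length_cons]
    exact Nat.succ_le_succ (ih.trans (Nat.right_le_pair _ _))

/-- The programs that halt within `s` steps. -/
def stageSet (c : Code) (U : List Bool →. List Bool) (s : ℕ) : Set U.Dom :=
  {p | (Code.evaln s c (Encodable.encode (p : List Bool))).isSome}

theorem stageSet_finite (c : Code) (U : List Bool →. List Bool) (s : ℕ) :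
    (stageSet c U s).Finite := by
  refine Set.Finite.of_finite_image (f := fun p : U.Dom => Encodable.encode (p : List Bool))
    ((Set.finite_Iio s).subset ?_) fun p _ q _ h => Subtype.ext (Encodable.encode_injective h)
  rintro _ ⟨p, hp, rfl⟩
  obtain ⟨y, hy⟩ := Option.isSome_iff_exists.1 hp
  exact Code.evaln_bound hy

theorem stageSum_eq {c : Code} {U : List Bool →. List Bool} (hc : IsCodeOf c U) (s : ℕ) :
    (stageSum c s : ℝ) / 2 ^ s =
      ∑ p ∈ (stageSet_finite c U s).toFinset, (1 / 2 : ℝ) ^ (p : List Bool).length := by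
  have h1 : stageSum c s = ∑ p ∈ (stageSet_finite c U s).toFinset,
      2 ^ (s - (p : List Bool).length) := by
    symm
    refine Finset.sum_of_injOn (fun p => Encodable.encode (p : List Bool))
      (fun p _ q _ h => Subtype.ext (Encodable.encode_injective h)) ?_ ?_ ?_
    · intro p hp
      obtain ⟨y, hy⟩ := Option.isSome_iff_exists.1 ((stageSet_finite c U s).mem_toFinset.1 hp)
      exact Finset.mem_coe.2 (Finset.mem_range.2 (Code.evaln_bound hy))
    · intro i _ hi
      rw [stageWeight]
      cases h : Code.evaln s c i with
      | none => rfl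
      | some y =>
        obtain ⟨p, x, rfl, hx, -⟩ := hc.mem_eval.1 (Code.evaln_sound h)
        refine absurd ⟨⟨p, Part.dom_iff_mem.2 ⟨x, hx⟩⟩, ?_, rfl⟩ hi
        rw [Finset.mem_coe, Set.Finite.mem_toFinset]
        exact Option.isSome_iff_exists.2 ⟨y, h⟩
    · intro p hp
      have hp' : (Code.evaln s c (Encodable.encode (p : List Bool))).isSome = true :=
        (stageSet_finite c U s).mem_toFinset.1 hp
      simp [stageWeight, hp']
  rw [h1, Nat.cast_sum, Finset.sum_div]
  refine Finset.sum_congr rfl fun p hp => ?_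
  obtain ⟨y, hy⟩ := Option.isSome_iff_exists.1 ((stageSet_finite c U s).mem_toFinset.1 hp)
  have hlt := (List.length_le_encode p).trans_lt (Code.evaln_bound hy)
  push_cast
  rw [pow_sub₀ _ two_ne_zero hlt.le]
  simp

theorem exists_stage {c : Code} {U : List Bool →. List Bool} (hc : IsCodeOf c U)
    (T : Finset U.Dom) : ∃ s, ∀ p ∈ T, p ∈ stageSet c U s := by
  have h : ∀ p : U.Dom, ∃ s, p ∈ stageSet c U s := fun p => by
    obtain ⟨x, hx⟩ := Part.dom_iff_mem.1 p.2
    obtain ⟨s, hs⟩ := Code.evaln_complete.1 (hc.mem_eval.2 ⟨p, x, rfl, hx, rfl⟩)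
    exact ⟨s, Option.isSome_iff_exists.2 ⟨_, hs⟩⟩
  choose s hs using h
  refine ⟨T.sup s, fun p hp => ?_⟩
  obtain ⟨y, hy⟩ := Option.isSome_iff_exists.1 (hs p)
  exact Option.isSome_iff_exists.2 ⟨y, Code.evaln_mono (Finset.le_sup hp) hy⟩

theorem exists_lt_stageSum {c : Code} {U : List Bool →. List Bool} (hc : IsCodeOf c U)
    (hU : IsPrefixFree U.Dom) {r : ℝ} (hr : r < haltingProbability U) :
    ∃ s, r < stageSum c s / 2 ^ s := by
  obtain ⟨T, hT⟩ := (hU.summable.hasSum.eventually_const_lt hr).exists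
  obtain ⟨s, hs⟩ := exists_stage hc T
  refine ⟨s, hT.trans_le ?_⟩
  rw [stageSum_eq hc]
  exact Finset.sum_le_sum_of_subset_of_nonneg
    (fun p hp => (stageSet_finite c U s).mem_toFinset.2 (hs p hp)) fun _ _ _ => by positivity

/-- A halting program not yet seen at stage `s` adds its full weight to the stage sum, so a nearly
exact stage sum rules out short late programs. -/
theorem stageSum_add_le {c : Code} {U : List Bool →. List Bool} (hc : IsCodeOf c U)
    (hU : IsPrefixFree U.Dom) {s : ℕ} {p : U.Dom} (hp : p ∉ stageSet c U s) :
    stageSum c s / 2 ^ s + (1 / 2 : ℝ) ^ (p : List Bool).length ≤ haltingProbability U := by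
  classical
  rw [stageSum_eq hc, add_comm, ← Finset.sum_insert (f := fun p : U.Dom =>
    (1 / 2 : ℝ) ^ (p : List Bool).length) (by rwa [Set.Finite.mem_toFinset])]
  exact hU.summable.sum_le_tsum _ fun _ _ => by positivity

/-- From a computable halting probability one can compute, for each `m`, a stage by which all
programs of length at most `m` that halt at all have halted. -/
theorem exists_computable_stage {c : Code} {U : List Bool →. List Bool} (hc : IsCodeOf c U)
    (hU : IsPrefixFree U.Dom) (h : IsComputableReal (haltingProbability U)) :
    ∃ σ : ℕ → ℕ, Computable σ ∧
      ∀ m, ∀ p : U.Dom, (p : List Bool).length ≤ m → p ∈ stageSet c U (σ m) := by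
  obtain ⟨a, b, ha, hb, hab⟩ := h
  -- With `ε = 2 ^ (-(m + 2))`, this is `a / b ≤ stage sum + 2 * ε`, denominators cleared: one `ε`
  -- for the rational approximation, one for the stage. Truncating a negative numerator to 0 does
  -- not change the outcome.
  let test : ℕ → ℕ → Bool := fun m s => decide ((a (m + 2)).toNat * (2 ^ s * 2 ^ (m + 2)) ≤
    b (m + 2) * (stageSum c s * 2 ^ (m + 2) + 2 * 2 ^ s))
  have htest : Computable₂ test := by
    have hm : Computable fun q : ℕ × ℕ => q.1 + 2 :=
      (Primrec.nat_add.comp Primrec.fst (Primrec.const 2)).to_comp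
    have hs : Computable fun q : ℕ × ℕ => 2 ^ q.2 :=
      (Primrec.nat_pow.comp (Primrec.const 2) Primrec.snd).to_comp
    have hk : Computable fun q : ℕ × ℕ => 2 ^ (q.1 + 2) :=
      (Primrec.nat_pow.comp (Primrec.const 2)
        (Primrec.nat_add.comp Primrec.fst (Primrec.const 2))).to_comp
    have hS : Computable fun q : ℕ × ℕ => stageSum c q.2 :=
      ((primrec_stageSum c).comp Primrec.snd).to_comp
    have hmul := Primrec.nat_mul.to_comp
    have hadd := Primrec.nat_add.to_comp
    have hle : Computable₂ fun x y : ℕ => decide (x ≤ y) := (PrimrecRel.decide Primrec.nat_le).to_comp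
    have h1 := hmul.comp (Primrec.int_toNat.to_comp.comp (ha.comp hm)) (hmul.comp hs hk)
    have h2 := hmul.comp (hb.comp hm)
      (hadd.comp (hmul.comp hS hk) (hmul.comp (Computable.const 2) hs))
    have h3 := hle.comp h1 h2
    exact h3
  have htest_iff : ∀ m s, test m s = true ↔
      (a (m + 2) : ℝ) / b (m + 2) ≤ stageSum c s / 2 ^ s + 2 * (1 / 2 ^ (m + 2)) := by
    intro m s
    have hb0 : (0 : ℝ) < b (m + 2) := by exact_mod_cast Nat.pos_of_ne_zero (hab (m + 2)).1
    rw [decide_eq_true_eq]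
    have h1 : (a (m + 2)).toNat * (2 ^ s * 2 ^ (m + 2)) ≤
        b (m + 2) * (stageSum c s * 2 ^ (m + 2) + 2 * 2 ^ s) ↔
        (a (m + 2)) * (2 ^ s * 2 ^ (m + 2)) ≤
        ((b (m + 2) * (stageSum c s * 2 ^ (m + 2) + 2 * 2 ^ s) : ℕ) : ℤ) := by
      rw [← Int.ofNat_le]
      rcases le_total 0 (a (m + 2)) with h0 | h0
      · push_cast
        rw [Int.toNat_of_nonneg h0]
      · rw [Int.toNat_of_nonpos h0]
        have : a (m + 2) * (2 ^ s * 2 ^ (m + 2)) ≤ 0 :=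
          mul_nonpos_of_nonpos_of_nonneg h0 (by positivity)
        constructor <;> intro _
        · exact this.trans (Int.natCast_nonneg _)
        · rw [zero_mul]
          exact Int.natCast_nonneg _
    rw [h1, ← Int.cast_le (R := ℝ), div_le_iff₀ hb0]
    push_cast
    have h2 : (0 : ℝ) < 2 ^ s * 2 ^ (m + 2) := by positivity
    rw [← mul_le_mul_iff_left₀ h2 (b := (a (m + 2) : ℝ))]
    refine iff_of_eq (congrArg _ ?_)
    field_simp
  have hex : ∀ m, ∃ s, test m s = true := by
    intro m
    have hpos : (0 : ℝ) < 1 / 2 ^ (m + 2) := by positivity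
    obtain ⟨s, hs⟩ := exists_lt_stageSum hc hU
      (sub_lt_self (haltingProbability U) hpos)
    refine ⟨s, (htest_iff m s).2 ?_⟩
    linarith [(abs_le.1 (hab (m + 2)).2).1]
  obtain ⟨σ, hσ, hσt⟩ := Computable.exists_choice htest hex
  refine ⟨σ, hσ, fun m p hpm => ?_⟩
  by_contra hp
  have h1 := stageSum_add_le hc hU hp
  have h2 := (htest_iff m _).1 (hσt m)
  have h3 := (abs_le.1 (hab (m + 2)).2).2
  have h4 : (1 / 2 : ℝ) ^ m ≤ (1 / 2 : ℝ) ^ (p : List Bool).length :=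
    pow_le_pow_of_le_one (by norm_num) (by norm_num) hpm
  have h5 : (1 : ℝ) / 2 ^ (m + 2) = (1 / 2) ^ m / 4 := by
    rw [pow_add, one_div_pow]; field_simp; norm_num
  have h6 : (0 : ℝ) < (1 / 2) ^ m := by positivity
  rw [h5] at h2 h3
  -- The halting probability is at most the stage sum plus `3 * ε`, whereas the missing program
  -- contributes at least `4 * ε`.
  linarith

/-! ### A prefix-free machine with unary programs -/

/-- The string `1 ... 10` with `n` ones. -/
def unary (n : ℕ) : List Bool := (List.range n).map (fun _ => true) ++ [false]

theorem unary_zero : unary 0 = [false] := rfl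

theorem unary_succ (n : ℕ) : unary (n + 1) = true :: unary n := by
  simp [unary, List.map_const']
  rfl

theorem length_unary (n : ℕ) : (unary n).length = n + 1 := by simp [unary]

theorem primrec_unary : Primrec unary :=
  Primrec.list_append.comp (Primrec.list_map Primrec.list_range (Primrec.const true).to₂)
    (Primrec.const [false])

theorem unary_prefix {m n : ℕ} (h : unary m <+: unary n) : m = n := by
  induction m generalizing n with
  | zero =>
    cases n with
    | zero => rfl
    | succ n => simp [unary_zero, unary_succ] at h
  | succ m ih =>
    cases n with
    | zero => simp [unary_zero, unary_succ] at h
    | succ n =>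
      rw [unary_succ, unary_succ, List.cons_prefix_cons] at h
      rw [ih h.2]

/-- The machine with output `h n` on the program `1 ... 10` with `n` ones. -/
def unaryMachine (h : ℕ → List Bool) : List Bool →. List Bool := fun p =>
  ((bif decide (p = unary (p.length - 1)) then some (h (p.length - 1)) else none :
    Option (List Bool)) : Part (List Bool))

/-- The truncated `p.length - 1` admits no spurious program: for the empty string it gives `unary
0`, which is nonempty. -/
theorem mem_unaryMachine {h : ℕ → List Bool} {p x : List Bool} :
    x ∈ unaryMachine h p ↔ ∃ n, p = unary n ∧ x = h n := by
  rw [unaryMachine, Part.mem_coe]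
  constructor
  · intro hx
    by_cases hp : p = unary (p.length - 1)
    · rw [decide_eq_true hp] at hx
      exact ⟨_, hp, (Option.some.inj hx).symm⟩
    · rw [decide_eq_false hp] at hx
      cases hx
  · rintro ⟨n, rfl, rfl⟩
    simp [length_unary]

theorem isPrefixFreeMachine_unaryMachine {h : ℕ → List Bool} (hh : Computable h) :
    IsPrefixFreeMachine (unaryMachine h) where
  partrec := by
    have hlen : Primrec fun p : List Bool => p.length - 1 :=
      Primrec.nat_sub.comp Primrec.list_length (Primrec.const 1)
    have heq : Primrec fun p : List Bool => decide (p = unary (p.length - 1)) :=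
      PrimrecPred.decide (Primrec.eq.comp Primrec.id (primrec_unary.comp hlen))
    exact Computable.ofOption (Computable.cond heq.to_comp
      (Computable.option_some.comp (hh.comp hlen.to_comp)) (Computable.const none))
  prefixFree := by
    intro p hp q hq hpq
    obtain ⟨x, hx⟩ := Part.dom_iff_mem.1 hp
    obtain ⟨y, hy⟩ := Part.dom_iff_mem.1 hq
    obtain ⟨m, rfl, -⟩ := mem_unaryMachine.1 hx
    obtain ⟨n, rfl, -⟩ := mem_unaryMachine.1 hy
    rw [unary_prefix hpq]

theorem IsUniversalPrefixFreeMachine.not_isComputableReal {U : List Bool →. List Bool}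
    (hU : IsUniversalPrefixFreeMachine U) : ¬ IsComputableReal (haltingProbability U) := by
  intro hΩ
  obtain ⟨c, hc⟩ := exists_isCodeOf hU.partrec
  obtain ⟨σ, hσ, hσU⟩ := exists_computable_stage hc hU.prefixFree hΩ
  have hh : Computable fun n => longString c (σ (2 * n)) :=
    (primrec_longString c).to_comp.comp
      (hσ.comp (Primrec.nat_mul.comp (Primrec.const 2) Primrec.id).to_comp)
  obtain ⟨d, hd⟩ := hU.universal _ (isPrefixFreeMachine_unaryMachine hh)
  -- For `n = d + 1` the simulating program has length at most `(n + 1) + d = 2 * n`, so its output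
  -- is among those that `longString` exceeds.
  obtain ⟨q, hq, hqU⟩ := hd (unary (d + 1)) _ (mem_unaryMachine.2 ⟨d + 1, rfl, rfl⟩)
  rw [length_unary] at hq
  have hstage := hσU (2 * (d + 1)) ⟨q, Part.dom_iff_mem.2 ⟨_, hqU⟩⟩
    (by change q.length ≤ _; omega)
  obtain ⟨y, hy⟩ := Option.isSome_iff_exists.1 hstage
  have hy' := Part.mem_unique (Code.evaln_sound hy) (hc.mem_eval.2 ⟨q, _, rfl, hqU, rfl⟩)
  subst hy'
  exact lt_irrefl _ (length_lt_longString hy)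

end HaltingProbability

theorem mainTheorem2 :
    (∀ U : List Bool →. List Bool, IsUniversalPrefixFreeMachine U →
      haltingProbability U ∉ EMLReal) ∧
    (∀ r : ℝ, ¬ IsComputableReal r → r ∉ EMLReal) :=
  ⟨fun _ hU h => hU.not_isComputableReal (isComputableReal_of_mem_EMLReal h),
    fun _ hr h => hr (isComputableReal_of_mem_EMLReal h)⟩
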